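/- **Group testing.** The $N$th problem ($N=1,2,\dots$) has $N$ items, of which $K=K(N)$ are defective, where $1\le K(N)\le N$; $K(N)$ is known, and the defective set $D$ is uniformly distributed over the subsets of size $K(N)$. Testing a set $S$ of items has the true result "positive" if $S\cap D\neq\emptyset$ and "negative" otherwise. An adaptive algorithm with $T$ tests chooses (possibly at random) the sets $S_1,\dots,S_T$ one after another, $S_i$ depending on the observed outcomes of the earlier tests, and finally outputs an estimate of $D$; it succeeds if the estimate equals $D$. The observed outcome of a test depends on its true result through one of the following noise models with parameter $p$, independently over tests: * erasure model: with probability $p$ the outcome is an erasure symbol, otherwise it is the true result; * symmetric error model: with probability $p$ the outcome is the opposite of the true result, otherwise it is the true result; * additive model: a negative test is reported positive with probability $p$ and negative otherwise, and a positive test is always reported positive. A constant $C\in\mathbb R$ is the *(adaptive group-testing) capacity* if for every $\epsilon>0$: any sequence of adaptive algorithms, with numbers of tests $T(N)$, such that $\liminf_{N\to\infty}\log_2\binom{N}{K(N)}/T(N)\ge C+\epsilon$ has success probability tending to $0$; and there is a sequence of adaptive algorithms with $\liminf_{N\to\infty}\log_2\binom{N}{K(N)}/T(N)\ge C-\epsilon$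 and success probability tending to $1$. (If $T(N)=0$, the ratio is read as $+\infty$ when $\binom{N}{K(N)}>1$ and as $0$ when $\binom{N}{K(N)}=1$.) **Theorem.** 1. If $0\le p<1$ and $K(N)=o(N)$, then the capacity for the erasure model exists and equals exactly $1-p$. 2. If $0\le p\le 1$, then for the symmetric error model the capacity, if it exists, is at most $1-h(p)$, where $h(p)=-p\log_2p-(1-p)\log_2(1-p)$, with $0\log_2 0=0$. 3. If $0\le p\le 1$, then for the additive model the capacity, if it exists, is at most $\log_2\bigl(1+(1-p)p^{p/(1-p)}\bigr)$, the capacity of the Z-channel (with $0^0=1$ at $p=0$, and with the expression read as its limit $0$ at $p=1$). -/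

import Mathlib

open scoped ENNReal

noncomputable section

namespace GroupTesting

/-- A deterministic adaptive group-testing algorithm for `N` items using `T` tests whose outcomes
lie in the alphabet `Y`. The set of items pooled in test `i` is a function of the outcomes of the
tests before `i`, and the estimate of the defective set is a function of all `T` outcomes. -/
structure AdaptiveAlgorithm (N T : ℕ) (Y : Type) where
  pool : (i : Fin T) → (Fin i.val → Y) → Finset (Fin N)
  decode : (Fin T → Y) → Finset (Fin N)

/-- The true (noiseless) result of testing the set `S` when the defective set is `D`: it is
positive exactly when `S` contains a defective item. -/
def isPositive {N : ℕ} (S D : Finset (Fin N)) : Bool :=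
  decide (S ∩ D).Nonempty

/-- The probability that the observed outcomes are `y` when `D` is the defective set and the tests
are chosen by `A`: given the past, the outcome of test `i` has law `W x`, where `x` is the true
result of the test, so that the noise of different tests is independent. -/
def AdaptiveAlgorithm.outcomeProb {N T : ℕ} {Y : Type} (A : AdaptiveAlgorithm N T Y)
    (W : Bool → Y → ℝ) (D : Finset (Fin N)) (y : Fin T → Y) : ℝ :=
  ∏ i : Fin T, W (isPositive (A.pool i (fun j => y ⟨j.val, j.isLt.trans i.isLt⟩)) D) (y i)

open Classical in
/-- The success probability of a deterministic algorithm when the defective set is uniformly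
distributed over the subsets of size `K` of the `N` items. -/
def AdaptiveAlgorithm.successProb {N T : ℕ} {Y : Type} [Fintype Y] (A : AdaptiveAlgorithm N T Y)
    (W : Bool → Y → ℝ) (K : ℕ) : ℝ :=
  (∑ D ∈ Finset.powersetCard K (Finset.univ : Finset (Fin N)),
    ∑ y : Fin T → Y, if A.decode y = D then A.outcomeProb W D y else 0) / (N.choose K : ℝ)

/-- A (possibly randomised) adaptive algorithm: a random choice, independent of the defective set
and of the noise, of a deterministic adaptive algorithm. -/
abbrev RandomisedAlgorithm (N T : ℕ) (Y : Type) := PMF (AdaptiveAlgorithm N T Y)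

/-- The success probability of a randomised algorithm. -/
def RandomisedAlgorithm.successProb {N T : ℕ} {Y : Type} [Fintype Y]
    (μ : RandomisedAlgorithm N T Y) (W : Bool → Y → ℝ) (K : ℕ) : ℝ :=
  ∑' A : AdaptiveAlgorithm N T Y, (μ A).toReal * A.successProb W K

/-- The rate `log₂ (N choose K) / T`, with value `∞` if `T = 0` and `N choose K > 1`. -/
def rate (N K T : ℕ) : ℝ≥0∞ :=
  ENNReal.ofReal (Real.logb 2 (N.choose K : ℝ)) / (T : ℝ≥0∞)

/-- `C` is the adaptive group-testing capacity for the noise model `W`, where `W x y` is the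
probability that a test with true result `x` (`true` is positive) has the observed outcome `y`, in
the regime in which the problem with `N` items has `K N` defective items. -/
def IsCapacity {Y : Type} [Fintype Y] (W : Bool → Y → ℝ) (K : ℕ → ℕ) (C : ℝ) : Prop :=
  ∀ ε : ℝ, 0 < ε →
    (∀ (T : ℕ → ℕ) (μ : (N : ℕ) → RandomisedAlgorithm N (T N) Y),
      ((C + ε : ℝ) : EReal)
          ≤ Filter.liminf (fun N => ((rate N (K N) (T N) : ℝ≥0∞) : EReal)) Filter.atTop →
      Filter.Tendsto (fun N => (μ N).successProb W (K N)) Filter.atTop (nhds 0)) ∧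
    (∃ (T : ℕ → ℕ) (μ : (N : ℕ) → RandomisedAlgorithm N (T N) Y),
      ((C - ε : ℝ) : EReal)
          ≤ Filter.liminf (fun N => ((rate N (K N) (T N) : ℝ≥0∞) : EReal)) Filter.atTop ∧
      Filter.Tendsto (fun N => (μ N).successProb W (K N)) Filter.atTop (nhds 1))

/-- Erasure model: with probability `p` the outcome is the erasure symbol `none`, otherwise the
true result is reported. -/
def erasureModel (p : ℝ) : Bool → Option Bool → ℝ
  | _, none => p
  | x, some y => if y = x then 1 - p else 0

/-- Symmetric error model: the true result is flipped with probability `p`. -/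
def symmetricModel (p : ℝ) : Bool → Bool → ℝ :=
  fun x y => if y = x then 1 - p else p

/-- Additive model (Z-channel): a negative test is reported positive with probability `p`; a
positive test is always reported positive. -/
def additiveModel (p : ℝ) : Bool → Bool → ℝ
  | true, true => 1
  | true, false => 0
  | false, true => p
  | false, false => 1 - p

end GroupTesting

end

/-! Converse. Fix an output law `q` and compare the outcomes, given `D`, with `T` independent draws
from `q`. Let `P` and `Q` be the two probabilities of an outcome sequence. If both conditional laws
`W x` have divergence at most `c` bits from `q`, then for small `s > 0` the tilted sum `∑ y, W x y *
(W x y / q y) ^ s` is at most `2 ^ (s * b)`, for any `b > c`. Peeling off the first test shows that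
adaptivity does not harm this bound: the `s`-th moment of `P / Q` is at most `2 ^ (s * b * T)`.
Where `P / Q` is below a threshold `t`, decoding succeeds with probability at most `t / M`, with `M
= N.choose K`, because `Q` does not depend on `D`; the rest is bounded by Markov. At rates above `c`
some power `t = M ^ θ` makes both terms vanish (`tendsto_successProb_zero`). For each noise model
`q` is chosen so that both divergences equal the claimed value.

Achievability for erasures. Generalised binary splitting finds `K` defectives with `K * (b + 3)`
noiseless tests, where `b` is about `log₂ (N / K)`; when `K = o(N)` this is asymptotically at most
`log₂ M`. Erasures are visible, so each erased test is repeated, at an average cost of `1 / (1 - p)`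
tests per answer, and a Chernoff bound controls the fluctuations. -/

open scoped ENNReal

noncomputable section

namespace GroupTesting

/-! ### Adaptive algorithms as trees: splitting off the first test -/

namespace AdaptiveAlgorithm

/-- The algorithm that tests `S` first and then continues with `A y`, where `y` is the outcome of
the first test. -/
def cons {N T : ℕ} {Y : Type} (S : Finset (Fin N)) (A : Y → AdaptiveAlgorithm N T Y) :
    AdaptiveAlgorithm N (T + 1) Y where
  pool := Fin.cases (fun _ => S) (fun i (past : Fin (i.val + 1) → Y) =>
    (A (past 0)).pool i (Fin.tail past))
  decode y := (A (y 0)).decode (Fin.tail y)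

/-- The first set tested by an algorithm. -/
def first {N T : ℕ} {Y : Type} (A : AdaptiveAlgorithm N (T + 1) Y) : Finset (Fin N) :=
  A.pool 0 Fin.elim0

/-- What remains of an algorithm once the first test has had the outcome `y`. -/
def after {N T : ℕ} {Y : Type} (A : AdaptiveAlgorithm N (T + 1) Y) (y : Y) :
    AdaptiveAlgorithm N T Y where
  pool i past := A.pool i.succ (Fin.cons (α := fun _ => Y) y past)
  decode z := A.decode (Fin.cons (α := fun _ => Y) y z)

variable {N T : ℕ} {Y : Type}

theorem outcomeProb_cons_outcome (A : AdaptiveAlgorithm N (T + 1) Y) (W : Bool → Y → ℝ)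
    (D : Finset (Fin N)) (y : Y) (z : Fin T → Y) :
    A.outcomeProb W D (Fin.cons (α := fun _ => Y) y z) =
      W (isPositive A.first D) y * (A.after y).outcomeProb W D z := by
  unfold outcomeProb
  rw [Fin.prod_univ_succ]
  congr 1
  · have : (fun j : Fin (0 : Fin (T + 1)).val => (Fin.cons (α := fun _ => Y) y z : Fin (T + 1) → Y)
        ⟨j.val, j.isLt.trans (0 : Fin (T + 1)).isLt⟩) = Fin.elim0 := by
      funext j
      exact j.elim0
    rw [this]
    rfl
  · refine Finset.prod_congr rfl fun i _ => ?_
    simp only [after, Fin.cons_succ]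
    congr 3
    funext j
    refine Fin.cases rfl (fun j => rfl) j

theorem first_cons (S : Finset (Fin N)) (A : Y → AdaptiveAlgorithm N T Y) :
    (cons S A).first = S := rfl

theorem after_cons (S : Finset (Fin N)) (A : Y → AdaptiveAlgorithm N T Y) (y : Y) :
    (cons S A).after y = A y := rfl

theorem outcomeProb_nonneg (A : AdaptiveAlgorithm N T Y) {W : Bool → Y → ℝ}
    (hW : ∀ x y, 0 ≤ W x y) (D : Finset (Fin N)) (y : Fin T → Y) : 0 ≤ A.outcomeProb W D y :=
  Finset.prod_nonneg fun _ _ => hW _ _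

end AdaptiveAlgorithm

theorem sum_fin_succ_fun {T : ℕ} {Y : Type} [Fintype Y] (f : (Fin (T + 1) → Y) → ℝ) :
    ∑ y, f y = ∑ y : Y, ∑ z : Fin T → Y, f (Fin.cons (α := fun _ => Y) y z) := by
  rw [← Fintype.sum_prod_type']
  exact (Equiv.sum_comp (Fin.consEquiv fun _ => Y) f).symm

/-! ### One-shot strong converse by change of measure -/

open AdaptiveAlgorithm

/-- The moment of order `s` of the likelihood ratio between the outcomes of an adaptive algorithm
and a product law grows at most exponentially in the number of tests. -/
theorem sum_outcomeProb_mul_rpow_le {N : ℕ} {Y : Type} [Fintype Y] {W : Bool → Y → ℝ} {q : Y → ℝ}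
    (hW : ∀ x y, 0 ≤ W x y) (hq : ∀ y, 0 ≤ q y) {s G : ℝ}
    (hG : ∀ x, ∑ y, W x y * (W x y / q y) ^ s ≤ G) (D : Finset (Fin N)) :
    ∀ {T : ℕ} (A : AdaptiveAlgorithm N T Y),
      ∑ y, A.outcomeProb W D y * (A.outcomeProb W D y / ∏ i, q (y i)) ^ s ≤ G ^ T
  | 0, A => by simp [outcomeProb]
  | T + 1, A => by
    have hG0 : 0 ≤ G := (Finset.sum_nonneg fun y _ => mul_nonneg (hW true y)
      (Real.rpow_nonneg (div_nonneg (hW _ _) (hq y)) s)).trans (hG true)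
    rw [sum_fin_succ_fun]
    calc _ = ∑ y, W (isPositive A.first D) y * (W (isPositive A.first D) y / q y) ^ s *
          ∑ z, (A.after y).outcomeProb W D z *
            ((A.after y).outcomeProb W D z / ∏ i, q (z i)) ^ s := by
          refine Finset.sum_congr rfl fun y _ => ?_
          rw [Finset.mul_sum]
          refine Finset.sum_congr rfl fun z _ => ?_
          rw [outcomeProb_cons_outcome, Fin.prod_univ_succ]
          simp only [Fin.cons_zero, Fin.cons_succ]
          rw [mul_div_mul_comm, Real.mul_rpow (div_nonneg (hW _ _) (hq y))
            (div_nonneg (outcomeProb_nonneg _ hW _ _) (Finset.prod_nonneg fun _ _ => hq _))]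
          ring
      _ ≤ ∑ y, W (isPositive A.first D) y * (W (isPositive A.first D) y / q y) ^ s * G ^ T :=
          Finset.sum_le_sum fun y _ => mul_le_mul_of_nonneg_left
            (sum_outcomeProb_mul_rpow_le hW hq hG D (A.after y))
            (mul_nonneg (hW _ _) (Real.rpow_nonneg (div_nonneg (hW _ _) (hq y)) s))
      _ ≤ G ^ (T + 1) := by
          rw [← Finset.sum_mul, pow_succ']
          exact mul_le_mul_of_nonneg_right (hG _) (pow_nonneg hG0 T)

theorem sum_outcomeProb {N : ℕ} {Y : Type} [Fintype Y] {W : Bool → Y → ℝ}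
    (hW1 : ∀ x, ∑ y, W x y = 1) (D : Finset (Fin N)) :
    ∀ {T : ℕ} (A : AdaptiveAlgorithm N T Y), ∑ y, A.outcomeProb W D y = 1
  | 0, A => by simp [outcomeProb]
  | T + 1, A => by
    simp only [sum_fin_succ_fun, outcomeProb_cons_outcome, ← Finset.mul_sum,
      sum_outcomeProb hW1 D (A.after _), mul_one, hW1]

/-- Pointwise Markov inequality: either the likelihood ratio `P / Q` is at most `t`, or it exceeds
`t` and the factor `(P / Q / t) ^ s` is at least `1`. -/
theorem le_mul_add_rpow_mul {P Q t s : ℝ} (hP : 0 ≤ P) (hQ : 0 ≤ Q) (hPQ : Q = 0 → P = 0)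
    (ht : 0 < t) (hs : 0 ≤ s) : P ≤ t * Q + t ^ (-s) * (P * (P / Q) ^ s) := by
  have h2 : 0 ≤ t ^ (-s) * (P * (P / Q) ^ s) := by positivity
  rcases le_or_gt P (t * Q) with h | h
  · linarith
  · have hQ' : 0 < Q := by
      rcases hQ.eq_or_lt with h0 | h0
      · simp [← h0, hPQ h0.symm] at h
      · exact h0
    have h3 : t ^ s ≤ (P / Q) ^ s :=
      Real.rpow_le_rpow ht.le ((le_div_iff₀ hQ').2 h.le) hs
    have h4 : 1 ≤ t ^ (-s) * (P / Q) ^ s := by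
      rw [Real.rpow_neg ht.le, inv_mul_eq_div, one_le_div (by positivity)]
      exact h3
    nlinarith [mul_nonneg ht.le hQ]

theorem sum_prod_eq_one {Y : Type} [Fintype Y] {q : Y → ℝ} (hq1 : ∑ y, q y = 1) (T : ℕ) :
    ∑ y : Fin T → Y, ∏ i, q (y i) = 1 := by
  classical
  rw [← Fintype.piFinset_univ, ← Finset.prod_univ_sum]
  simp [hq1]

theorem AdaptiveAlgorithm.successProb_nonneg {N T : ℕ} {Y : Type} [Fintype Y]
    (A : AdaptiveAlgorithm N T Y) {W : Bool → Y → ℝ} (hW : ∀ x y, 0 ≤ W x y) (K : ℕ) :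
    0 ≤ A.successProb W K := by
  unfold successProb
  refine div_nonneg (Finset.sum_nonneg fun D _ => Finset.sum_nonneg fun y _ => ?_)
    (Nat.cast_nonneg _)
  split_ifs
  · exact outcomeProb_nonneg A hW D y
  · exact le_rfl

theorem AdaptiveAlgorithm.successProb_le_one {N T : ℕ} {Y : Type} [Fintype Y]
    (A : AdaptiveAlgorithm N T Y) {W : Bool → Y → ℝ} (hW : ∀ x y, 0 ≤ W x y)
    (hW1 : ∀ x, ∑ y, W x y = 1) (K : ℕ) : A.successProb W K ≤ 1 := by
  unfold successProb
  refine div_le_one_of_le₀ ?_ (Nat.cast_nonneg _)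
  calc _ ≤ ∑ D ∈ Finset.powersetCard K (Finset.univ : Finset (Fin N)), (1 : ℝ) := by
        refine Finset.sum_le_sum fun D _ => le_trans (Finset.sum_le_sum fun y _ => ?_)
          (sum_outcomeProb hW1 D A).le
        split_ifs
        · exact le_rfl
        · exact outcomeProb_nonneg A hW D y
    _ = _ := by simp

/-- A one-shot strong converse bound: comparison of an adaptive algorithm with an arbitrary product
law `q` of the outcomes. -/
theorem AdaptiveAlgorithm.successProb_le {N T : ℕ} {Y : Type} [Fintype Y]
    (A : AdaptiveAlgorithm N T Y) {W : Bool → Y → ℝ} {q : Y → ℝ}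
    (hW : ∀ x y, 0 ≤ W x y) (hq : ∀ y, 0 ≤ q y) (hq1 : ∑ y, q y = 1)
    (hWq : ∀ x y, q y = 0 → W x y = 0) {s t G : ℝ} (hs : 0 ≤ s) (ht : 0 < t)
    (hG : ∀ x, ∑ y, W x y * (W x y / q y) ^ s ≤ G) {K : ℕ} (hK : K ≤ N) :
    A.successProb W K ≤ t / (N.choose K : ℝ) + t ^ (-s) * G ^ T := by
  classical
  have hM : (0 : ℝ) < N.choose K := by exact_mod_cast Nat.choose_pos hK
  unfold successProb
  rw [div_le_iff₀ hM, add_mul, div_mul_cancel₀ _ hM.ne']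
  have hQ : ∀ y : Fin T → Y, 0 ≤ ∏ i, q (y i) := fun y => Finset.prod_nonneg fun _ _ => hq _
  have key : ∀ D y, A.outcomeProb W D y ≤ t * ∏ i, q (y i) +
      t ^ (-s) * (A.outcomeProb W D y * (A.outcomeProb W D y / ∏ i, q (y i)) ^ s) := by
    intro D y
    refine le_mul_add_rpow_mul (outcomeProb_nonneg A hW D y) (hQ y) (fun h => ?_) ht hs
    obtain ⟨i, -, hi⟩ := Finset.prod_eq_zero_iff.1 h
    exact Finset.prod_eq_zero (Finset.mem_univ i) (hWq _ _ hi)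
  calc _ ≤ ∑ D ∈ Finset.powersetCard K (Finset.univ : Finset (Fin N)), ∑ y : Fin T → Y,
        ((if A.decode y = D then t * ∏ i, q (y i) else 0) +
        t ^ (-s) * (A.outcomeProb W D y * (A.outcomeProb W D y / ∏ i, q (y i)) ^ s)) := by
        refine Finset.sum_le_sum fun D _ => Finset.sum_le_sum fun y _ => ?_
        split_ifs
        · exact key D y
        · rw [zero_add]
          have := outcomeProb_nonneg A hW D y
          have := hQ y
          positivity
    _ = (∑ D ∈ Finset.powersetCard K (Finset.univ : Finset (Fin N)), ∑ y : Fin T → Y,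
          if A.decode y = D then t * ∏ i, q (y i) else 0) +
        ∑ D ∈ Finset.powersetCard K (Finset.univ : Finset (Fin N)), t ^ (-s) *
          ∑ y, A.outcomeProb W D y * (A.outcomeProb W D y / ∏ i, q (y i)) ^ s := by
        simp only [Finset.sum_add_distrib, Finset.mul_sum]
    _ ≤ t + ∑ D ∈ Finset.powersetCard K (Finset.univ : Finset (Fin N)), t ^ (-s) * G ^ T := by
        gcongr with D hD
        -- For each `y` at most one `D` equals `A.decode y`, so the sum over `D` is absorbed and the
        -- total mass of the product law remains.
        · rw [Finset.sum_comm]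
          calc _ ≤ ∑ y : Fin T → Y, t * ∏ i, q (y i) := by
                refine Finset.sum_le_sum fun y _ => ?_
                rw [Finset.sum_ite_eq]
                split_ifs
                · exact le_rfl
                · exact mul_nonneg ht.le (hQ y)
            _ = t := by rw [← Finset.mul_sum, sum_prod_eq_one hq1, mul_one]
        · exact sum_outcomeProb_mul_rpow_le hW hq hG D A
    _ = _ := by simp [mul_comm]

/-! ### Randomised algorithms as averages of deterministic ones -/

theorem RandomisedAlgorithm.hasSum_toReal {N T : ℕ} {Y : Type} (μ : RandomisedAlgorithm N T Y) :
    HasSum (fun A => (μ A).toReal) 1 := by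
  have h := ENNReal.hasSum_toReal (f := fun A => μ A) (by rw [PMF.tsum_coe]; simp)
  rwa [← ENNReal.tsum_toReal_eq (fun A => PMF.apply_ne_top μ A), PMF.tsum_coe,
    ENNReal.toReal_one] at h

theorem RandomisedAlgorithm.summable_mul_successProb {N T : ℕ} {Y : Type} [Fintype Y]
    (μ : RandomisedAlgorithm N T Y) {W : Bool → Y → ℝ} (hW : ∀ x y, 0 ≤ W x y)
    (hW1 : ∀ x, ∑ y, W x y = 1) (K : ℕ) :
    Summable fun A : AdaptiveAlgorithm N T Y => (μ A).toReal * A.successProb W K :=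
  Summable.of_nonneg_of_le
    (fun A => mul_nonneg ENNReal.toReal_nonneg (A.successProb_nonneg hW K))
    (fun A => mul_le_of_le_one_right ENNReal.toReal_nonneg (A.successProb_le_one hW hW1 K))
    μ.hasSum_toReal.summable

theorem RandomisedAlgorithm.successProb_nonneg {N T : ℕ} {Y : Type} [Fintype Y]
    (μ : RandomisedAlgorithm N T Y) {W : Bool → Y → ℝ} (hW : ∀ x y, 0 ≤ W x y) (K : ℕ) :
    0 ≤ μ.successProb W K :=
  tsum_nonneg fun A => mul_nonneg ENNReal.toReal_nonneg (A.successProb_nonneg hW K)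

theorem RandomisedAlgorithm.successProb_le_of_forall {N T : ℕ} {Y : Type} [Fintype Y]
    (μ : RandomisedAlgorithm N T Y) {W : Bool → Y → ℝ} (hW : ∀ x y, 0 ≤ W x y)
    (hW1 : ∀ x, ∑ y, W x y = 1) {K : ℕ} {B : ℝ}
    (hB : ∀ A : AdaptiveAlgorithm N T Y, A.successProb W K ≤ B) : μ.successProb W K ≤ B := by
  have h := μ.hasSum_toReal.mul_right B
  rw [one_mul] at h
  rw [← h.tsum_eq]
  exact Summable.tsum_le_tsum
    (fun A => mul_le_mul_of_nonneg_left (hB A) ENNReal.toReal_nonneg)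
    (μ.summable_mul_successProb hW hW1 K) h.summable

theorem RandomisedAlgorithm.successProb_pure {N T : ℕ} {Y : Type} [Fintype Y]
    (A : AdaptiveAlgorithm N T Y) (W : Bool → Y → ℝ) (K : ℕ) :
    RandomisedAlgorithm.successProb (PMF.pure A) W K = A.successProb W K := by
  classical
  unfold RandomisedAlgorithm.successProb
  rw [tsum_eq_single A]
  · simp
  · intro B hB
    simp [PMF.pure_apply, hB]

/-! ### Asymptotic strong converse -/

open Filter Topology

theorem eventually_lt_of_hasDerivAt_neg {f : ℝ → ℝ} {d x : ℝ} (h : HasDerivAt f d x) (hd : d < 0) :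
    ∀ᶠ s in 𝓝[>] x, f s < f x := by
  have h1 := (hasDerivAt_iff_tendsto_slope.1 h).mono_left
    (nhdsWithin_mono x fun s (hs : x < s) => ne_of_gt hs)
  filter_upwards [h1.eventually (gt_mem_nhds hd), self_mem_nhdsWithin] with s hs hx
  rw [slope_def_field] at hs
  have hx' : 0 < s - x := sub_pos.2 hx
  by_contra! hc
  exact absurd hs (not_lt.2 (div_nonneg (sub_nonneg.2 hc) hx'.le))

/-- At `b = 0` the power `b ^ s` jumps from `1` to `0` as `s` leaves `0`, hence the requirement that
`a` vanish there. -/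
theorem hasDerivAt_mul_const_rpow_zero {a b : ℝ} (hb : 0 ≤ b) (hab : b = 0 → a = 0) :
    HasDerivAt (fun s : ℝ => a * b ^ s) (a * Real.log b) 0 := by
  rcases hb.eq_or_lt with h | h
  · simpa [hab h.symm] using hasDerivAt_const (0 : ℝ) (0 : ℝ)
  · simpa using ((hasDerivAt_id (0 : ℝ)).const_rpow h).const_mul a

/-- If the divergence of each conditional output law from `q` is less than `c` bits, the tilted
sums are at most `2 ^ (s * c)` for small positive `s`. -/
theorem exists_pos_sum_mul_rpow_le {Y : Type} [Fintype Y] {W : Bool → Y → ℝ} {q : Y → ℝ}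
    (hW : ∀ x y, 0 ≤ W x y) (hW1 : ∀ x, ∑ y, W x y = 1) (hq : ∀ y, 0 ≤ q y)
    (hWq : ∀ x y, q y = 0 → W x y = 0) {c : ℝ}
    (hc : ∀ x, ∑ y, W x y * Real.log (W x y / q y) < c * Real.log 2) :
    ∃ s : ℝ, 0 < s ∧ ∀ x, ∑ y, W x y * (W x y / q y) ^ s ≤ (2 : ℝ) ^ (s * c) := by
  have h : ∀ x, ∀ᶠ s in 𝓝[>] (0 : ℝ),
      ∑ y, W x y * (W x y / q y) ^ s ≤ (2 : ℝ) ^ (s * c) := by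
    intro x
    have h1 : HasDerivAt (fun s : ℝ => ∑ y, W x y * (W x y / q y) ^ s)
        (∑ y, W x y * Real.log (W x y / q y)) 0 :=
      HasDerivAt.fun_sum fun y _ => hasDerivAt_mul_const_rpow_zero (div_nonneg (hW x y) (hq y))
        fun h0 => (div_eq_zero_iff.1 h0).elim id (hWq x y)
    have h2 : HasDerivAt (fun s : ℝ => (2 : ℝ) ^ (s * c)) (c * Real.log 2) 0 := by
      have := ((hasDerivAt_id (0 : ℝ)).mul_const c).const_rpow (a := 2) (by norm_num)
      simpa [mul_comm] using this
    have h3 := eventually_lt_of_hasDerivAt_neg (h1.sub h2) (sub_neg.2 (hc x))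
    filter_upwards [h3] with s hs
    simp only [Pi.sub_apply, Real.rpow_zero, mul_one, hW1, zero_mul, sub_self] at hs
    exact (sub_neg.1 hs).le
  -- At `s = 0` both sides equal `1` and the left one has the smaller derivative. There are only two
  -- inputs, so one `s` serves both.
  obtain ⟨s, ⟨h1, h2⟩, h3⟩ := (((h true).and (h false)).and self_mem_nhdsWithin).exists
  exact ⟨s, h3, fun x => by cases x <;> assumption⟩

/-- A positive rate rules out `N.choose K = 1`, whose rate is `0` even for `T = 0`; otherwise `T =
0` is harmless in the product form. -/
theorem mul_le_logb_of_lt_rate {N K T : ℕ} {a : ℝ} (ha : 0 < a)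
    (h : (a : EReal) < ((rate N K T : ℝ≥0∞) : EReal)) :
    1 < N.choose K ∧ a * T ≤ Real.logb 2 (N.choose K : ℝ) := by
  have ha' : ((ENNReal.ofReal a : ℝ≥0∞) : EReal) = a := by
    rw [EReal.coe_ennreal_ofReal, max_eq_left ha.le]
  rw [← ha', EReal.coe_ennreal_lt_coe_ennreal_iff, rate] at h
  have hL : 0 < Real.logb 2 (N.choose K : ℝ) := by
    by_contra! hL
    simp [ENNReal.ofReal_of_nonpos hL] at h
  constructor
  · by_contra! hM
    interval_cases N.choose K <;> simp at hL
  · have h2 := ENNReal.mul_le_of_le_div h.le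
    rw [← ENNReal.ofReal_natCast, ← ENNReal.ofReal_mul ha.le] at h2
    exact (ENNReal.ofReal_le_ofReal_iff hL.le).1 h2

theorem le_rate {N K T : ℕ} {a : ℝ} (hT : T ≠ 0)
    (h : a * T ≤ Real.logb 2 (N.choose K : ℝ)) :
    (a : EReal) ≤ ((rate N K T : ℝ≥0∞) : EReal) := by
  rcases le_or_gt a 0 with ha | ha
  · exact (EReal.coe_le_coe_iff.2 ha).trans (EReal.coe_ennreal_nonneg _)
  have ha' : ((ENNReal.ofReal a : ℝ≥0∞) : EReal) = a := by
    rw [EReal.coe_ennreal_ofReal, max_eq_left ha.le]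
  rw [← ha', EReal.coe_ennreal_le_coe_ennreal_iff, rate,
    ENNReal.le_div_iff_mul_le (Or.inl (by exact_mod_cast hT)) (Or.inl (ENNReal.natCast_ne_top T)),
    ← ENNReal.ofReal_natCast, ← ENNReal.ofReal_mul ha.le]
  exact ENNReal.ofReal_le_ofReal h

/-- Makes the number of candidate sets tend to infinity as soon as the rate stays positive, without
any assumption on the growth of `K`. -/
theorem le_choose_of_one_lt_choose {N K : ℕ} (hK : 1 ≤ K) (hKN : K ≤ N) (h : 1 < N.choose K) :
    N ≤ N.choose K := by
  have hne : K ≠ N := by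
    rintro rfl
    simp at h
  clear h
  induction N generalizing K with
  | zero => omega
  | succ n ih =>
    obtain ⟨k, rfl⟩ : ∃ k, K = k + 1 := ⟨K - 1, by omega⟩
    rw [Nat.choose_succ_succ']
    have h1 : 0 < n.choose k := Nat.choose_pos (by omega)
    rcases eq_or_ne (k + 1) n with h2 | h2
    · subst h2
      simp
    · have := ih hK (by omega) h2
      omega

/-- The strong converse: at rates above the largest divergence from `q` of the conditional output
laws the success probability vanishes. -/
theorem tendsto_successProb_zero {Y : Type} [Fintype Y] {W : Bool → Y → ℝ} {q : Y → ℝ}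
    (hW : ∀ x y, 0 ≤ W x y) (hW1 : ∀ x, ∑ y, W x y = 1) (hq : ∀ y, 0 ≤ q y) (hq1 : ∑ y, q y = 1)
    (hWq : ∀ x y, q y = 0 → W x y = 0) {c : ℝ} (hc0 : 0 ≤ c)
    (hc : ∀ x, ∑ y, W x y * Real.log (W x y / q y) ≤ c * Real.log 2)
    {K : ℕ → ℕ} (hK : ∀ N : ℕ, 1 ≤ N → 1 ≤ K N ∧ K N ≤ N)
    (T : ℕ → ℕ) (μ : (N : ℕ) → RandomisedAlgorithm N (T N) Y) {c' : ℝ} (hcc' : c < c')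
    (hr : (c' : EReal) ≤ liminf (fun N => ((rate N (K N) (T N) : ℝ≥0∞) : EReal)) atTop) :
    Tendsto (fun N => (μ N).successProb W (K N)) atTop (𝓝 0) := by
  -- With `c < b < a < c'`, the gap above `c` gives the tilting exponent, and the tests number at
  -- most `log₂ M / a`, where `M = N.choose (K N)`.
  obtain ⟨a, hca, hac'⟩ := exists_between hcc'
  obtain ⟨b, hcb, hba⟩ := exists_between hca
  have ha : 0 < a := hc0.trans_lt hca
  obtain ⟨s, hs, hG⟩ := exists_pos_sum_mul_rpow_le hW hW1 hq hWq (c := b) fun x =>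
    (hc x).trans_lt (mul_lt_mul_of_pos_right hcb (Real.log_pos one_lt_two))
  -- The threshold will be `t = M ^ θ`: `θ < 1` makes `t / M` vanish, and `θ > b / a` makes `t ^
  -- (-s) * 2 ^ (s * b * T)` vanish.
  obtain ⟨θ, hθ, hθ1⟩ := exists_between ((div_lt_one ha).2 hba)
  have hb : 0 < b := hc0.trans_lt hcb
  have hev : ∀ᶠ N in atTop, 1 < N.choose (K N) ∧ a * T N ≤ Real.logb 2 (N.choose (K N) : ℝ) := by
    have := eventually_lt_of_lt_liminf ((EReal.coe_lt_coe_iff.2 hac').trans_le hr)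
    filter_upwards [this] with N hN using mul_le_logb_of_lt_rate ha hN
  have hM : Tendsto (fun N : ℕ => (N.choose (K N) : ℝ)) atTop atTop := by
    refine tendsto_atTop_mono' _ ?_ tendsto_natCast_atTop_atTop
    filter_upwards [hev, eventually_ge_atTop 1] with N hN h1
    exact_mod_cast le_choose_of_one_lt_choose (hK N h1).1 (hK N h1).2 hN.1
  have hlim : Tendsto (fun N : ℕ => (N.choose (K N) : ℝ) ^ (-(1 - θ)) +
      (N.choose (K N) : ℝ) ^ (-(s * (θ - b / a)))) atTop (𝓝 0) := by
    simpa using ((tendsto_rpow_neg_atTop (sub_pos.2 hθ1)).comp hM).add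
      ((tendsto_rpow_neg_atTop (mul_pos hs (sub_pos.2 hθ))).comp hM)
  refine squeeze_zero' (Eventually.of_forall fun N => (μ N).successProb_nonneg hW _) ?_ hlim
  filter_upwards [hev, eventually_ge_atTop 1] with N hN h1
  refine (μ N).successProb_le_of_forall hW hW1 fun A => ?_
  have hM1 : (0 : ℝ) < N.choose (K N) := by exact_mod_cast one_pos.trans hN.1
  refine (A.successProb_le hW hq hq1 hWq hs.le (Real.rpow_pos_of_pos hM1 θ) hG (hK N h1).2).trans ?_
  refine add_le_add (le_of_eq ?_) ?_
  · rw [neg_sub, Real.rpow_sub_one hM1.ne']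
  · have h2 : ((2 : ℝ) ^ (s * b)) ^ T N ≤ (N.choose (K N) : ℝ) ^ (s * (b / a)) := by
      rw [← Real.rpow_natCast, ← Real.rpow_mul (by norm_num)]
      calc (2 : ℝ) ^ (s * b * T N) ≤ 2 ^ (Real.logb 2 (N.choose (K N) : ℝ) * (s * (b / a))) := by
            refine Real.rpow_le_rpow_of_exponent_le one_le_two ?_
            calc s * b * T N = s * (b / a) * (a * T N) := by field_simp
              _ ≤ s * (b / a) * Real.logb 2 (N.choose (K N) : ℝ) :=
                mul_le_mul_of_nonneg_left hN.2 (by positivity)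
              _ = _ := mul_comm _ _
        _ = _ := by
            rw [Real.rpow_mul (by norm_num), Real.rpow_logb (by norm_num) (by norm_num) hM1]
    calc _ ≤ ((N.choose (K N) : ℝ) ^ θ) ^ (-s) * (N.choose (K N) : ℝ) ^ (s * (b / a)) := by gcongr
      _ = _ := by
        rw [← Real.rpow_mul hM1.le, ← Real.rpow_add hM1]
        congr 1
        ring

/-- If `c < C`, the algorithms of rate halfway between would have success probability tending both
to `0` and to `1`. -/
theorem IsCapacity.le_of_forall_tendsto_zero {Y : Type} [Fintype Y] {W : Bool → Y → ℝ}
    {K : ℕ → ℕ} {c C : ℝ} (hC : IsCapacity W K C)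
    (h : ∀ c', c < c' → ∀ (T : ℕ → ℕ) (μ : (N : ℕ) → RandomisedAlgorithm N (T N) Y),
      (c' : EReal) ≤ liminf (fun N => ((rate N (K N) (T N) : ℝ≥0∞) : EReal)) atTop →
      Tendsto (fun N => (μ N).successProb W (K N)) atTop (𝓝 0)) : C ≤ c := by
  by_contra! hlt
  obtain ⟨T, μ, hr, h1⟩ := (hC ((C - c) / 2) (by linarith)).2
  exact zero_ne_one (tendsto_nhds_unique (h _ (by linarith) T μ hr) h1)

theorem IsCapacity.le {Y : Type} [Fintype Y] {W : Bool → Y → ℝ} {K : ℕ → ℕ} {C C' : ℝ}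
    (hC : IsCapacity W K C) (hC' : IsCapacity W K C') : C ≤ C' :=
  hC.le_of_forall_tendsto_zero fun c' hc' T μ hr =>
    (hC' (c' - C') (sub_pos.2 hc')).1 T μ (by simpa using hr)

/-! ### Upper bounds for the three noise models -/

theorem symmetricModel_nonneg {p : ℝ} (hp0 : 0 ≤ p) (hp1 : p ≤ 1) (x y : Bool) :
    0 ≤ symmetricModel p x y := by
  unfold symmetricModel
  split_ifs <;> linarith

/-- For uniform `q` both conditional laws have divergence `log 2 - binEntropy p`, in nats. -/
theorem capacity_symmetricModel_le {K : ℕ → ℕ} (hK : ∀ N : ℕ, 1 ≤ N → 1 ≤ K N ∧ K N ≤ N)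
    {p : ℝ} (hp0 : 0 ≤ p) (hp1 : p ≤ 1) {C : ℝ} (hC : IsCapacity (symmetricModel p) K C) :
    C ≤ 1 - Real.binEntropy p / Real.log 2 := by
  have hl : 0 < Real.log 2 := Real.log_pos one_lt_two
  refine hC.le_of_forall_tendsto_zero fun c' hc' T μ hr =>
    tendsto_successProb_zero (q := fun _ => 1 / 2) (symmetricModel_nonneg hp0 hp1)
      (fun x => by cases x <;> simp [symmetricModel]) (by norm_num) (by norm_num) (by norm_num)
      ?_ ?_ hK T μ hc' hr
  · rw [sub_nonneg, div_le_one hl]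
    exact Real.binEntropy_le_log_two
  · have key : ∀ a : ℝ, a * Real.log (a / (1 / 2)) = a * Real.log 2 + a * Real.log a := by
      intro a
      rcases eq_or_ne a 0 with rfl | ha
      · simp
      · rw [Real.log_div ha (by norm_num), one_div, Real.log_inv]
        ring
    intro x
    rw [sub_mul, div_mul_cancel₀ _ hl.ne']
    cases x <;> simp only [Fintype.sum_bool, symmetricModel, key, Real.binEntropy, Real.log_inv] <;>
      simp <;> linarith

theorem additiveModel_nonneg {p : ℝ} (hp0 : 0 ≤ p) (hp1 : p ≤ 1) (x y : Bool) :
    0 ≤ additiveModel p x y := by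
  cases x <;> cases y <;> simp only [additiveModel] <;> linarith

/-- The law `q` equalises the divergences. A positive test contributes `-log (q true)`, so `q true =
1 / Z` gives `log Z`; the identity `(1 - p) * log r = p * log p` then gives `log Z` for a negative
test too. -/
theorem capacity_additiveModel_le {K : ℕ → ℕ} (hK : ∀ N : ℕ, 1 ≤ N → 1 ≤ K N ∧ K N ≤ N)
    {p : ℝ} (hp0 : 0 ≤ p) (hp1 : p ≤ 1) {C : ℝ} (hC : IsCapacity (additiveModel p) K C) :
    C ≤ Real.logb 2 (1 + (1 - p) * p ^ (p / (1 - p))) := by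
  have hl : 0 < Real.log 2 := Real.log_pos one_lt_two
  set r : ℝ := p ^ (p / (1 - p)) with hr_def
  have hr0 : 0 ≤ (1 - p) * r := mul_nonneg (by linarith) (Real.rpow_nonneg hp0 _)
  have hr : p < 1 → 0 < r := by
    intro h
    rcases hp0.eq_or_lt with h0 | h0
    · rw [hr_def, ← h0]
      simp
    · exact Real.rpow_pos_of_pos h0 _
  have hlr : p < 1 → (1 - p) * Real.log r = p * Real.log p := by
    intro h
    rcases hp0.eq_or_lt with h0 | h0
    · rw [hr_def, ← h0]
      simp
    · have : 1 - p ≠ 0 := by linarith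
      rw [hr_def, Real.log_rpow h0]
      field_simp
  set Z : ℝ := 1 + (1 - p) * r with hZ_def
  have hZ : 0 < Z := by linarith
  refine hC.le_of_forall_tendsto_zero fun c' hc' T μ hrate =>
    tendsto_successProb_zero (q := fun y => if y then 1 / Z else (1 - p) * r / Z)
      (additiveModel_nonneg hp0 hp1) (fun x => by cases x <;> simp [additiveModel])
      ?_ ?_ ?_ ?_ ?_ hK T μ hc' hrate
  · intro y
    split_ifs <;> positivity
  · rw [Fintype.sum_bool]
    simp only [if_true, Bool.false_eq_true, if_false]
    rw [← add_div, ← hZ_def, div_self hZ.ne']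
  -- `q false` vanishes only at `p = 1`, where no test is ever reported negative.
  · rintro x (_ | _) h
    · simp only [Bool.false_eq_true, if_false, div_eq_zero_iff, hZ.ne', or_false,
        mul_eq_zero] at h
      have hp : 1 - p = 0 := by
        rcases h with h | h
        · exact h
        · by_contra h1
          exact (hr (lt_of_le_of_ne hp1 fun h2 => h1 (by linarith))).ne' h
      cases x <;> simp [additiveModel, hp]
    · simp [hZ.ne'] at h
  · exact Real.logb_nonneg one_lt_two (by linarith)
  · intro x
    rw [Real.logb, div_mul_cancel₀ _ hl.ne', Fintype.sum_bool]
    cases x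
    · simp only [additiveModel, if_true, Bool.false_eq_true, if_false]
      have h1 : p * Real.log (p / (1 / Z)) = p * Real.log p + p * Real.log Z := by
        rcases hp0.eq_or_lt with h0 | h0
        · simp [← h0]
        · rw [div_div_eq_mul_div, div_one, Real.log_mul h0.ne' hZ.ne']
          ring
      rcases hp1.eq_or_lt with h2 | h2
      · rw [h1]
        simp [h2]
      · have h3 : (1 - p) / ((1 - p) * r / Z) = Z / r := by
          have : 1 - p ≠ 0 := by linarith
          have := (hr h2).ne'
          field_simp
        rw [h1, h3, Real.log_div hZ.ne' (hr h2).ne', ← hlr h2]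
        linarith
    · simp [additiveModel]

theorem erasureModel_nonneg {p : ℝ} (hp0 : 0 ≤ p) (hp1 : p ≤ 1) (x : Bool) (y : Option Bool) :
    0 ≤ erasureModel p x y := by
  rcases y with _ | y
  · exact hp0
  · simp only [erasureModel]
    split_ifs <;> linarith

theorem sum_erasureModel (p : ℝ) (x : Bool) : ∑ y, erasureModel p x y = 1 := by
  cases x <;> simp [Fintype.sum_option, erasureModel]

/-- With `q` keeping mass `p` on the erasure and halving the rest, each non-erased outcome has
likelihood ratio `2`, so both divergences are `1 - p` bits. -/
theorem tendsto_successProb_erasureModel_zero {K : ℕ → ℕ}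
    (hK : ∀ N : ℕ, 1 ≤ N → 1 ≤ K N ∧ K N ≤ N) {p : ℝ} (hp0 : 0 ≤ p) (hp1 : p < 1)
    (T : ℕ → ℕ) (μ : (N : ℕ) → RandomisedAlgorithm N (T N) (Option Bool)) {c : ℝ} (hc : 1 - p < c)
    (hr : (c : EReal) ≤ liminf (fun N => ((rate N (K N) (T N) : ℝ≥0∞) : EReal)) atTop) :
    Tendsto (fun N => (μ N).successProb (erasureModel p) (K N)) atTop (𝓝 0) := by
  refine tendsto_successProb_zero (q := fun y => y.elim p fun _ => (1 - p) / 2)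
    (erasureModel_nonneg hp0 hp1.le) (sum_erasureModel p) ?_ ?_ ?_ (sub_nonneg.2 hp1.le) ?_
    hK T μ hc hr
  · rintro (_ | _)
    · exact hp0
    · simp only [Option.elim]
      linarith
  · simp only [Fintype.sum_option, Option.elim, Fintype.sum_bool]
    ring
  · rintro x (_ | y) h
    · exact h
    · simp only [Option.elim] at h
      linarith
  · intro x
    have h1 : Real.log (p / p) = 0 := by
      rcases eq_or_ne p 0 with h | h
      · simp [h]
      · simp [div_self h]
    have h2 : (1 - p) / ((1 - p) / 2) = 2 := by
      have : 1 - p ≠ 0 := by linarith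
      field_simp
    cases x <;> simp [Fintype.sum_option, erasureModel, h1, h2]

/-! ### Noiseless adaptive strategies and generalised binary splitting -/

/-- `Solvable n F` says that `n` noiseless adaptive tests suffice to identify a defective set that
is known to belong to the family `F`. -/
def Solvable {N : ℕ} : ℕ → Set (Finset (Fin N)) → Prop
  | 0, F => F.Subsingleton
  | n + 1, F => ∃ S : Finset (Fin N), Solvable n {D ∈ F | isPositive S D = true} ∧
      Solvable n {D ∈ F | isPositive S D = false}

section DecisionTrees

variable {N : ℕ}

theorem isPositive_eq_true {S D : Finset (Fin N)} : isPositive S D = true ↔ ∃ x ∈ S, x ∈ D := by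
  simp [isPositive, Finset.Nonempty]

theorem isPositive_eq_false {S D : Finset (Fin N)} : isPositive S D = false ↔ ∀ x ∈ S, x ∉ D := by
  rw [← Bool.not_eq_true, isPositive_eq_true]
  push Not
  rfl

theorem Solvable.mono_family {n : ℕ} {F F' : Set (Finset (Fin N))} (h : Solvable n F)
    (hF : F' ⊆ F) : Solvable n F' := by
  induction n generalizing F F' with
  | zero => exact Set.Subsingleton.anti h hF
  | succ n ih =>
    obtain ⟨S, h1, h2⟩ := h
    exact ⟨S, ih h1 fun D hD => ⟨hF hD.1, hD.2⟩, ih h2 fun D hD => ⟨hF hD.1, hD.2⟩⟩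

theorem Solvable.succ {n : ℕ} {F : Set (Finset (Fin N))} (h : Solvable n F) : Solvable (n + 1) F :=
  ⟨∅, h.mono_family fun _ hD => hD.1, h.mono_family fun _ hD => hD.1⟩

theorem Solvable.mono {n m : ℕ} {F : Set (Finset (Fin N))} (h : Solvable n F) (hnm : n ≤ m) :
    Solvable m F :=
  Nat.le_induction h (fun _ _ => Solvable.succ) m hnm

theorem Solvable.of_subsingleton {n : ℕ} {F : Set (Finset (Fin N))} (h : F.Subsingleton) :
    Solvable n F :=
  Solvable.mono (n := 0) h (Nat.zero_le n)

/-- Binary search: a defective item of a set of at most `2 ^ b` items that contains one is found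
with `b` tests. -/
theorem Solvable.of_binary_search {m : ℕ} : ∀ {b : ℕ} {F : Set (Finset (Fin N))}
    {S : Finset (Fin N)}, S.card ≤ 2 ^ b → (∀ D ∈ F, ∃ x ∈ S, x ∈ D) →
    (∀ x ∈ S, Solvable m {D ∈ F | x ∈ D}) → Solvable (m + b) F
  | 0, F, S, hS, hF, h => by
    rcases F.eq_empty_or_nonempty with rfl | ⟨D₀, hD₀⟩
    · exact .of_subsingleton Set.subsingleton_empty
    obtain ⟨x, hx, -⟩ := hF D₀ hD₀
    refine (h x hx).mono_family fun D hD => ⟨hD, ?_⟩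
    obtain ⟨y, hy, hyD⟩ := hF D hD
    rwa [Finset.card_le_one.1 hS x hx y hy]
  | b + 1, F, S, hS, hF, h => by
    obtain ⟨S₁, hS₁, hc⟩ := Finset.exists_subset_card_eq (s := S) (n := min (2 ^ b) S.card)
      (min_le_right _ _)
    have hc' : (S \ S₁).card ≤ 2 ^ b := by
      rw [Finset.card_sdiff_of_subset hS₁, hc]
      rw [pow_succ] at hS
      omega
    refine ⟨S₁, Solvable.of_binary_search (S := S₁) (hc.trans_le (min_le_left _ _))
      (fun D hD => isPositive_eq_true.1 hD.2)
      (fun x hx => (h x (hS₁ hx)).mono_family fun D hD => ⟨hD.1.1, hD.2⟩),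
      Solvable.of_binary_search (S := S \ S₁) hc' (fun D hD => ?_)
      (fun x hx => (h x (Finset.mem_sdiff.1 hx).1).mono_family fun D hD => ⟨hD.1.1, hD.2⟩)⟩
    obtain ⟨x, hx, hxD⟩ := hF D hD.1
    exact ⟨x, Finset.mem_sdiff.2 ⟨hx, fun h1 => isPositive_eq_false.1 hD.2 x h1 hxD⟩, hxD⟩

/-- Generalised binary splitting: if at most `k` of the items of `U` are defective, where `U` has at
most `m * 2 ^ b` elements, then `m + k * (b + 1)` tests suffice to find them. -/
theorem Solvable.of_card_inter_le (b : ℕ) {m k : ℕ} {F : Set (Finset (Fin N))}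
    {U E : Finset (Fin N)} (hU : U.card ≤ m * 2 ^ b) (hE : ∀ D ∈ F, D \ U = E)
    (hk : ∀ D ∈ F, (D ∩ U).card ≤ k) : Solvable (m + k * (b + 1)) F := by
  -- Each round tests a block of at most `2 ^ b` items of `U`. A negative answer discards the block
  -- and lowers `m` at the cost of one test; a positive one starts a binary search, which finds a
  -- defective and lowers `k` at the cost of `b + 1` tests.
  induction hn : m + k generalizing m k F U E with
  | zero =>
    obtain ⟨rfl, rfl⟩ : m = 0 ∧ k = 0 := by omega
    refine .of_subsingleton fun D hD D' hD' => ?_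
    have hU' : U = ∅ := by simpa using hU
    subst hU'
    simpa using (hE D hD).trans (hE D' hD').symm
  | succ n ih =>
    rcases U.eq_empty_or_nonempty with rfl | hne
    · refine .of_subsingleton fun D hD D' hD' => ?_
      simpa using (hE D hD).trans (hE D' hD').symm
    obtain ⟨m, rfl⟩ : ∃ m', m = m' + 1 := by
      refine ⟨m - 1, ?_⟩
      have := hne.card_pos
      rcases m with _ | m
      · simp at hU
        simp [hU] at hne
      · rfl
    obtain ⟨S, hSU, hS⟩ := Finset.exists_subset_card_eq (s := U) (n := min (2 ^ b) U.card)
      (min_le_right _ _)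
    rw [add_right_comm]
    refine ⟨S, ?_, ?_⟩
    · rcases k with _ | k
      · refine .of_subsingleton fun D hD => ?_
        obtain ⟨x, hx, hxD⟩ := isPositive_eq_true.1 hD.2
        have h1 := hk D hD.1
        rw [Nat.le_zero, Finset.card_eq_zero] at h1
        exact absurd (Finset.mem_inter.2 ⟨hxD, hSU hx⟩) (h1 ▸ Finset.notMem_empty x)
      · have h1 : m + (k + 1) * (b + 1) = (m + 1 + k * (b + 1)) + b := by ring
        rw [h1]
        refine Solvable.of_binary_search (S := S) (hS.trans_le (min_le_left _ _))
          (fun D hD => isPositive_eq_true.1 hD.2) fun x hx => ?_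
        refine ih (U := U.erase x) (E := insert x E)
          ((Finset.card_le_card (Finset.erase_subset _ _)).trans hU) (fun D hD => ?_)
          (fun D hD => ?_) (by omega)
        · rw [← hE D hD.1.1]
          ext y
          by_cases hy : y = x
          · subst hy
            simp [hD.2]
          · simp [hy]
        · have h2 : D ∩ U.erase x = (D ∩ U).erase x := by
            ext y
            simp only [Finset.mem_inter, Finset.mem_erase]
            tauto
          rw [h2, Finset.card_erase_of_mem (Finset.mem_inter.2 ⟨hD.2, hSU hx⟩)]
          have := hk D hD.1.1
          omega
    · refine ih (U := U \ S) (E := E) ?_ (fun D hD => ?_) (fun D hD => ?_) (by omega)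
      · rw [Finset.card_sdiff_of_subset hSU, hS]
        rw [add_mul] at hU
        omega
      · rw [← hE D hD.1]
        ext y
        have := isPositive_eq_false.1 hD.2 y
        simp only [Finset.mem_sdiff]
        tauto
      · exact (Finset.card_le_card (Finset.inter_subset_inter_left Finset.sdiff_subset)).trans
          (hk D hD.1)

/-! ### Simulating a noiseless strategy under erasures -/

/-- Repeating every erased test of a noiseless strategy gives an algorithm for the erasure model.
Its failure probability satisfies a Chernoff bound for the number of non-erased tests. -/
theorem exists_algorithm_of_solvable {p u : ℝ} (hp0 : 0 ≤ p) (hp1 : p ≤ 1) (hu : 1 ≤ u) :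
    ∀ (T : ℕ) {n : ℕ} {F : Set (Finset (Fin N))}, Solvable n F →
      ∃ A : AdaptiveAlgorithm N T (Option Bool), ∀ D ∈ F,
        1 - u ^ n * (p + (1 - p) / u) ^ T ≤
          ∑ y, if A.decode y = D then A.outcomeProb (erasureModel p) D y else 0
  | T, 0, F, h => by
    have hv : 0 ≤ p + (1 - p) / u := add_nonneg hp0 (div_nonneg (by linarith) (by linarith))
    rcases F.eq_empty_or_nonempty with rfl | ⟨D₀, hD₀⟩
    · exact ⟨⟨fun _ _ => ∅, fun _ => ∅⟩, fun D hD => hD.elim⟩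
    · refine ⟨⟨fun _ _ => ∅, fun _ => D₀⟩, fun D hD => ?_⟩
      have hD' : D₀ = D := h hD₀ hD
      simp only [hD', if_true, sum_outcomeProb (sum_erasureModel p), pow_zero, one_mul]
      linarith [pow_nonneg hv T]
  | 0, n + 1, F, h => by
    refine ⟨⟨fun _ _ => ∅, fun _ => ∅⟩, fun D hD => le_trans ?_ (Finset.sum_nonneg fun y _ => ?_)⟩
    -- With no tests left the claimed lower bound is nonpositive, since `u ≥ 1`.
    · have := one_le_pow₀ hu (n := n + 1)
      simpa using this
    · split_ifs
      · exact AdaptiveAlgorithm.outcomeProb_nonneg _ (erasureModel_nonneg hp0 hp1) D y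
      · exact le_rfl
  | T + 1, n + 1, F, h => by
    have hu0 : 0 < u := by linarith
    obtain ⟨B₀, h₀⟩ := exists_algorithm_of_solvable hp0 hp1 hu T h
    obtain ⟨S, ht, hf⟩ := h
    obtain ⟨B₁, h₁⟩ := exists_algorithm_of_solvable hp0 hp1 hu T ht
    obtain ⟨B₂, h₂⟩ := exists_algorithm_of_solvable hp0 hp1 hu T hf
    -- An erasure leaves both `F` and the number `n + 1` of required answers unchanged, so `B₀`
    -- starts the same problem again with `T` tests.
    let B : Option Bool → AdaptiveAlgorithm N T (Option Bool) :=
      fun y => y.elim B₀ fun x => if x then B₁ else B₂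
    have hB : ∀ D ∈ F, 1 - u ^ (n + 1) * (p + (1 - p) / u) ^ (T + 1) ≤
        p * (∑ y, if (B none).decode y = D then
          (B none).outcomeProb (erasureModel p) D y else 0) +
        (1 - p) * (∑ y, if (B (some (isPositive S D))).decode y = D then
          (B (some (isPositive S D))).outcomeProb (erasureModel p) D y else 0) := by
      intro D hD
      -- The failure bound satisfies the recursion exactly: `p + (1 - p) / u` is the mean of `u⁻¹`
      -- raised to the number of non-erased outcomes of one test.
      have e : 1 - u ^ (n + 1) * (p + (1 - p) / u) ^ (T + 1) =
          p * (1 - u ^ (n + 1) * (p + (1 - p) / u) ^ T) +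
          (1 - p) * (1 - u ^ n * (p + (1 - p) / u) ^ T) := by
        have : u ^ (n + 1) * (p + (1 - p) / u) = p * u ^ (n + 1) + (1 - p) * u ^ n := by
          field_simp
          ring
        linear_combination (-(p + (1 - p) / u) ^ T) * this
      rw [e]
      refine add_le_add (mul_le_mul_of_nonneg_left (h₀ D hD) hp0)
        (mul_le_mul_of_nonneg_left ?_ (by linarith))
      cases hx : isPositive S D
      · exact h₂ D ⟨hD, hx⟩
      · exact h₁ D ⟨hD, hx⟩
    refine ⟨AdaptiveAlgorithm.cons S B, fun D hD => (hB D hD).trans (le_of_eq ?_)⟩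
    rw [sum_fin_succ_fun]
    have hd : ∀ y z, (AdaptiveAlgorithm.cons S B).decode
        (Fin.cons (α := fun _ => Option Bool) y z) = (B y).decode z := fun _ _ => rfl
    simp only [AdaptiveAlgorithm.outcomeProb_cons_outcome, AdaptiveAlgorithm.first_cons,
      AdaptiveAlgorithm.after_cons, hd, ← mul_ite_zero, ← Finset.mul_sum, Fintype.sum_option]
    congr 1
    cases isPositive S D <;> simp [erasureModel]

end DecisionTrees

/-! ### Achievability for the erasure model -/

/-- Integer form of `(N / K) ^ K ≤ N.choose K`. The induction peels off the factor `(N + 1) / (K +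
1) ≥ q`, and `q ≥ 1` preserves the hypothesis. -/
theorem pow_le_choose_of_mul_le {q : ℕ} (hq : 1 ≤ q) : ∀ {N K : ℕ}, q * K ≤ N → q ^ K ≤ N.choose K
  | _, 0, _ => by simp
  | 0, K + 1, h => by
    have : 0 < q * (K + 1) := by positivity
    omega
  | N + 1, K + 1, h => by
    have h1 : q * K ≤ N := by
      rw [mul_add] at h
      omega
    refine Nat.le_of_mul_le_mul_right (c := K + 1) ?_ K.succ_pos
    rw [← Nat.add_one_mul_choose_eq]
    calc q ^ (K + 1) * (K + 1) = (q * (K + 1)) * q ^ K := by ring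
      _ ≤ (N + 1) * N.choose K := Nat.mul_le_mul h (pow_le_choose_of_mul_le hq h1)

/-- The function equals `1` at `u = 1` and has derivative `1 - (1 - p) * τ < 0` there. -/
theorem exists_one_lt_mul_rpow_lt_one {p τ : ℝ} (hτ : 1 < (1 - p) * τ) :
    ∃ u : ℝ, 1 < u ∧ u * (p + (1 - p) / u) ^ τ < 1 := by
  have h1 : HasDerivAt (fun u : ℝ => p + (1 - p) / u) (-(1 - p)) 1 := by
    have := ((hasDerivAt_inv (one_ne_zero (α := ℝ))).const_mul (1 - p)).const_add p
    simpa [div_eq_mul_inv] using this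
  have h2 := (hasDerivAt_id (1 : ℝ)).mul (h1.rpow_const (p := τ) (Or.inl (by simp)))
  have h3 := eventually_lt_of_hasDerivAt_neg h2 (by simp; linarith)
  obtain ⟨u, hu, hu1⟩ := (h3.and self_mem_nhdsWithin).exists
  exact ⟨u, hu1, by simpa using hu⟩

/-- Splitting into `2 * K` blocks of size `2 ^ b` costs `2 * K + K * (b + 1) = K * (b + 3)` answers.
-/
theorem exists_algorithm_erasureModel {p u : ℝ} (hp0 : 0 ≤ p) (hp1 : p ≤ 1) (hu : 1 ≤ u)
    {N K b : ℕ} (hKN : K ≤ N) (hb : N ≤ 2 * K * 2 ^ b) (T : ℕ) :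
    ∃ A : AdaptiveAlgorithm N T (Option Bool),
      1 - u ^ (K * (b + 3)) * (p + (1 - p) / u) ^ T ≤ A.successProb (erasureModel p) K := by
  have hsol : Solvable (2 * K + K * (b + 1)) {D : Finset (Fin N) | D.card = K} :=
    Solvable.of_card_inter_le b (U := Finset.univ) (E := ∅) (by simpa using hb) (by simp)
      (fun D hD => by simpa using le_of_eq hD)
  obtain ⟨A, hA⟩ := exists_algorithm_of_solvable hp0 hp1 hu T
    (hsol.mono (m := K * (b + 3)) (by linarith))
  refine ⟨A, ?_⟩
  have hM : (0 : ℝ) < N.choose K := by exact_mod_cast Nat.choose_pos hKN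
  unfold AdaptiveAlgorithm.successProb
  rw [le_div_iff₀ hM]
  calc _ = ∑ D ∈ Finset.powersetCard K (Finset.univ : Finset (Fin N)),
        (1 - u ^ (K * (b + 3)) * (p + (1 - p) / u) ^ T) := by simp; ring
    _ ≤ _ := by
        refine Finset.sum_le_sum fun D hD => ?_
        convert hA D (Finset.mem_powersetCard.1 hD).2

theorem exists_rate_ge_of_lt {K : ℕ → ℕ} (hK : ∀ N : ℕ, 1 ≤ N → 1 ≤ K N ∧ K N ≤ N)
    (hKo : (fun N : ℕ => (K N : ℝ)) =o[atTop] (fun N : ℕ => (N : ℝ)))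
    {p a : ℝ} (hp0 : 0 ≤ p) (hp1 : p < 1) (ha : a < 1 - p) :
    ∃ (T : ℕ → ℕ) (μ : (N : ℕ) → RandomisedAlgorithm N (T N) (Option Bool)),
      (a : EReal) ≤ liminf (fun N => ((rate N (K N) (T N) : ℝ≥0∞) : EReal)) atTop ∧
      Tendsto (fun N => (μ N).successProb (erasureModel p) (K N)) atTop (𝓝 1) := by
  -- With `max a 0 < a' < a'' < 1 - p`, the gap above `a''` makes the failure probability decay, and
  -- the gap between `a'` and `a''` pays for rounding and for the extra `3` in `b + 3`.
  obtain ⟨a', haa', ha'⟩ := exists_between (max_lt ha (sub_pos.2 hp1))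
  obtain ⟨haa', ha0⟩ := max_lt_iff.1 haa'
  obtain ⟨a'', h1, h2⟩ := exists_between ha'
  have ha0'' : 0 < a'' := ha0.trans h1
  -- `τ = 1 / a''` tests per test of the noiseless strategy
  obtain ⟨u, hu, hρ⟩ := exists_one_lt_mul_rpow_lt_one (p := p) (τ := 1 / a'')
    (by rw [mul_one_div, one_lt_div ha0'']; exact h2)
  set v : ℝ := p + (1 - p) / u with hv_def
  have hu0 : 0 < u := by linarith
  have hv : 0 < v := add_pos_of_nonneg_of_pos hp0 (div_pos (by linarith) hu0)
  have hv1 : v ≤ 1 := by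
    have : (1 - p) / u ≤ 1 - p := div_le_self (by linarith) hu.le
    linarith
  set b : ℕ → ℕ := fun N => Nat.log 2 (N / K N) with hb_def
  set n : ℕ → ℕ := fun N => K N * (b N + 3) with hn_def
  set T : ℕ → ℕ := fun N => ⌈1 / a'' * n N⌉₊ with hT_def
  -- The only use of `K = o(N)`: it sends `b` to infinity, so that the constant overhead per
  -- defective becomes negligible.
  have hquot : Tendsto (fun N => N / K N) atTop atTop := by
    refine tendsto_atTop.2 fun m => ?_
    filter_upwards [hKo.bound (c := 1 / (m + 1)) (by positivity), eventually_ge_atTop 1]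
      with N hN hN1
    rw [Real.norm_natCast, Real.norm_natCast, one_div, inv_mul_eq_div,
      le_div_iff₀ (by positivity)] at hN
    rw [Nat.le_div_iff_mul_le (hK N hN1).1]
    have h3 : K N * (m + 1) ≤ N := by exact_mod_cast hN
    linarith
  have hb : Tendsto b atTop atTop := by
    refine tendsto_atTop.2 fun m => ?_
    filter_upwards [hquot.eventually_ge_atTop (2 ^ m)] with N hN
    exact Nat.le_log_of_pow_le one_lt_two hN
  have hn : Tendsto n atTop atTop := by
    refine tendsto_atTop_mono' _ ?_ hb
    filter_upwards [eventually_ge_atTop 1] with N hN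
    have := (hK N hN).1
    calc b N ≤ 1 * (b N + 3) := by omega
      _ ≤ K N * (b N + 3) := Nat.mul_le_mul_right _ this
  have hA : ∀ N, ∃ A : AdaptiveAlgorithm N (T N) (Option Bool), 1 ≤ N →
      1 - u ^ n N * v ^ T N ≤ A.successProb (erasureModel p) (K N) := by
    intro N
    rcases Nat.eq_zero_or_pos N with h0 | h0
    · exact ⟨⟨fun _ _ => ∅, fun _ => ∅⟩, fun h => by omega⟩
    · have hbN : N ≤ 2 * K N * 2 ^ b N := by
        have h3 := Nat.lt_pow_succ_log_self one_lt_two (N / K N)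
        have h4 := (Nat.div_lt_iff_lt_mul (hK N h0).1).1 h3
        rw [pow_succ] at h4
        calc N ≤ _ := h4.le
          _ = _ := by ring
      obtain ⟨A, hA⟩ := exists_algorithm_erasureModel hp0 hp1.le hu.le (hK N h0).2 hbN (T N)
      exact ⟨A, fun _ => hA⟩
  choose A hA using hA
  refine ⟨T, fun N => PMF.pure (A N), ?_, ?_⟩
  · have hev : ∀ᶠ N in atTop, a' * (1 / a'' * (b N + 3) + 1) ≤ b N := by
      have hlt : 0 < 1 - a' / a'' := sub_pos.2 ((div_lt_one ha0'').2 h1)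
      have := (tendsto_natCast_atTop_atTop (R := ℝ)).comp hb
      filter_upwards [this.eventually_ge_atTop ((a' * (3 / a'' + 1)) / (1 - a' / a''))] with N hN
      rw [div_le_iff₀ hlt] at hN
      simp only [Function.comp_apply] at hN
      calc a' * (1 / a'' * (b N + 3) + 1) = a' * (3 / a'' + 1) + a' / a'' * b N := by ring
        _ ≤ _ := by linarith
    refine le_liminf_of_le (by isBoundedDefault) ?_
    filter_upwards [hev, eventually_ge_atTop 1, hn.eventually_ge_atTop 1,
      hquot.eventually_ge_atTop 1] with N hN hN1 hnN hqN
    have hK1 : (1 : ℝ) ≤ K N := by exact_mod_cast (hK N hN1).1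
    have hn1 : (1 : ℝ) ≤ n N := by exact_mod_cast hnN
    have hTpos : T N ≠ 0 := (Nat.ceil_pos.2 (by positivity)).ne'
    refine (EReal.coe_le_coe_iff.2 haa'.le).trans (le_rate hTpos ?_)
    have hT : (T N : ℝ) ≤ K N * (1 / a'' * (b N + 3) + 1) := by
      have h3 := (Nat.ceil_lt_add_one (a := 1 / a'' * n N) (by positivity)).le
      have h4 : (n N : ℝ) = K N * (b N + 3) := by simp [hn_def]
      calc (T N : ℝ) ≤ 1 / a'' * n N + 1 := h3
        _ = K N * (1 / a'' * (b N + 3)) + 1 := by rw [h4]; ring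
        _ ≤ _ := by linarith
    have hchoose : (b N : ℝ) * K N ≤ Real.logb 2 (N.choose (K N) : ℝ) := by
      -- Rounding `N / K` down to the power `2 ^ b` gives at least `b * K` bits, against about `K *
      -- (b + 3) / a''` tests.
      have h3 : 2 ^ b N * K N ≤ N :=
        (Nat.le_div_iff_mul_le (hK N hN1).1).1 (Nat.pow_log_le_self 2 (by omega))
      have h4 := pow_le_choose_of_mul_le Nat.one_le_two_pow h3
      rw [← pow_mul] at h4
      rw [Real.le_logb_iff_rpow_le one_lt_two (by exact_mod_cast Nat.choose_pos (hK N hN1).2),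
        ← Nat.cast_mul, Real.rpow_natCast]
      exact_mod_cast h4
    calc a' * T N ≤ a' * (K N * (1 / a'' * (b N + 3) + 1)) :=
          mul_le_mul_of_nonneg_left hT ha0.le
      _ = K N * (a' * (1 / a'' * (b N + 3) + 1)) := by ring
      _ ≤ K N * b N := mul_le_mul_of_nonneg_left hN (by linarith)
      _ ≤ _ := by rwa [mul_comm]
  · simp only [RandomisedAlgorithm.successProb_pure]
    have hlim : Tendsto (fun N => 1 - (u * v ^ (1 / a'')) ^ n N) atTop (𝓝 1) := by
      have := (tendsto_pow_atTop_nhds_zero_of_lt_one (by positivity) hρ).comp hn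
      simpa using this.const_sub 1
    refine tendsto_of_tendsto_of_tendsto_of_le_of_le' hlim tendsto_const_nhds ?_
      (Eventually.of_forall fun N => AdaptiveAlgorithm.successProb_le_one _
        (erasureModel_nonneg hp0 hp1.le) (sum_erasureModel p) _)
    filter_upwards [eventually_ge_atTop 1] with N hN
    refine le_trans ?_ (hA N hN)
    -- As `v ≤ 1`, rounding `T` up only decreases `v ^ T`, so the failure probability is at most the
    -- `n`-th power of `u * v ^ (1 / a'') < 1`.
    rw [mul_pow]
    refine sub_le_sub_left (mul_le_mul_of_nonneg_left ?_ (by positivity)) 1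
    rw [← Real.rpow_natCast, ← Real.rpow_natCast, ← Real.rpow_mul hv.le]
    exact Real.rpow_le_rpow_of_exponent_ge hv hv1 (Nat.le_ceil _)

theorem isCapacity_erasureModel {K : ℕ → ℕ} (hK : ∀ N : ℕ, 1 ≤ N → 1 ≤ K N ∧ K N ≤ N)
    (hKo : (fun N : ℕ => (K N : ℝ)) =o[atTop] (fun N : ℕ => (N : ℝ)))
    {p : ℝ} (hp0 : 0 ≤ p) (hp1 : p < 1) : IsCapacity (erasureModel p) K (1 - p) := fun ε hε =>
  ⟨fun T μ hr => tendsto_successProb_erasureModel_zero hK hp0 hp1 T μ (by linarith) hr,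
    exists_rate_ge_of_lt hK hKo hp0 hp1 (by linarith)⟩

end GroupTesting

end

theorem theorem1p3 (K : ℕ → ℕ) (hK : ∀ N : ℕ, 1 ≤ N → 1 ≤ K N ∧ K N ≤ N)
    (p : ℝ) (hp0 : 0 ≤ p) (hp1 : p ≤ 1) :
    (p < 1 → (fun N : ℕ => (K N : ℝ)) =o[Filter.atTop] (fun N : ℕ => (N : ℝ)) →
      ∀ C : ℝ, GroupTesting.IsCapacity (GroupTesting.erasureModel p) K C ↔ C = 1 - p) ∧
    (∀ C : ℝ, GroupTesting.IsCapacity (GroupTesting.symmetricModel p) K C →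
      C ≤ 1 - Real.binEntropy p / Real.log 2) ∧
    (∀ C : ℝ, GroupTesting.IsCapacity (GroupTesting.additiveModel p) K C →
      C ≤ Real.logb 2 (1 + (1 - p) * p ^ (p / (1 - p)))) := by
  refine ⟨fun hp hKo C => ⟨fun hC => ?_, ?_⟩,
    fun C => GroupTesting.capacity_symmetricModel_le hK hp0 hp1,
    fun C => GroupTesting.capacity_additiveModel_le hK hp0 hp1⟩
  · have h := GroupTesting.isCapacity_erasureModel hK hKo hp0 hp
    exact le_antisymm (hC.le h) (h.le hC)
  · rintro rfl
    exact GroupTesting.isCapacity_erasureModel hK hKo hp0 hp
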